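/- Let $\mathcal H$ be a complex Hilbert space, $\mathcal H\otimes\mathcal H$ the Hilbert space tensor product, $P_-=\frac12(1-F)$ with $F(\eta\otimes\zeta)=\zeta\otimes\eta$, $\mathcal H\wedge\mathcal H=P_-(\mathcal H\otimes\mathcal H)$ and $\eta\wedge\zeta=\sqrt2\,P_-(\eta\otimes\zeta)$. For $l\in\mathbb N$ let $V_l^{\otimes2}$ be the set of unit vectors of $\mathcal H\otimes\mathcal H$ that are linear combinations of at most $l$ unit product vectors $\eta\otimes\zeta$ with $\|\eta\|=\|\zeta\|=1$ (Schmidt rank at most $l$), and let $V_l^{\wedge2}$ be the set of unit vectors of $\mathcal H\wedge\mathcal H$ that are linear combinations of at most $l$ unit vectors of the form $\eta\wedge\zeta$ (Slater rank at most $l$). Let $K_l^{\otimes2}$ and $K_l^{\wedge2}$ be the norm-closed convex hulls of $\{\omega_{\xi,\eta}:\xi,\eta\in V_l^{\otimes2}\}$ and $\{\omega_{\xi,\eta}:\xi,\eta\in V_l^{\wedge2}\}$ in the preduals of $\mathcal B(\mathcal H\otimes\mathcal H)$ and $\mathcal B(\mathcal H\wedge\mathcal H)$, where $\omega_{\xi,\eta}(x)=\langle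 x\xi,\eta\rangle$ and $\omega_\xi=\omega_{\xi,\xi}$, and for such a set $K$ let $q_K(\psi)=\inf\{\alpha\ge0:\psi\in\alpha K\}\in[0,\infty]$. A functional $\varphi$ on $\mathcal B(\mathcal H\wedge\mathcal H)$ is regarded as a functional on $\mathcal B(\mathcal H\otimes\mathcal H)$ through $x\mapsto\varphi(P_-xP_-)$. Let $l\ge2$. (a) For every normal state $\varphi$ on $\mathcal B(\mathcal H\wedge\mathcal H)$, $$\tfrac12\,q_{K_l^{\otimes2}}(\varphi)\le q_{K_l^{\wedge2}}(\varphi)\le q_{K_l^{\otimes2}}(\varphi).$$ (b) Let $k\ge1$, let $e_1,\dots,e_k,f_1,\dots,f_k$ be an orthonormal system in $\mathcal H$ and $\xi_k=\frac1{\sqrt k}\sum_{i=1}^k e_i\wedge f_i$. Then $\omega_{\xi_k}$ is a normal state on $\mathcal B(\mathcal H\wedge\mathcal H)$. If $2k\le l$, then $q_{K_l^{\otimes2}}(\omega_{\xi_k})=q_{K_l^{\wedge2}}(\omega_{\xi_k})=1$. If $k=l$, then $q_{K_l^{\otimes2}}(\omega_{\xi_k})=2$ and $q_{K_l^{\wedge2}}(\omega_{\xi_k})=1$.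 (c) Consequently, if $\mathcal H$ is infinite dimensional, then each of the two inequalities in (a) is an equality, with finite nonzero values, for some normal state $\varphi$ (with $q_{K_l^{\wedge2}}(\varphi)=1$), and neither can be sharpened: if $c\in[0,\infty]$ satisfies $c\,q_{K_l^{\otimes2}}(\varphi)\le q_{K_l^{\wedge2}}(\varphi)$ for all normal states $\varphi$ on $\mathcal B(\mathcal H\wedge\mathcal H)$, then $c\le\frac12$; if $c$ satisfies $q_{K_l^{\wedge2}}(\varphi)\le c\,q_{K_l^{\otimes2}}(\varphi)$ for all of them, then $c\ge1$. -/

import Mathlib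

open scoped TensorProduct Pointwise ENNReal NNReal InnerProductSpace ComplexOrder

noncomputable section

namespace Entanglement

section General

variable (E : Type*) [NormedAddCommGroup E] [InnerProductSpace ℂ E]

/-- The bounded operators `B(E)`. -/
abbrev BOp : Type _ := E →L[ℂ] E

/-- The bounded linear functionals on `B(E)`, with the dual norm. -/
abbrev BDual : Type _ := BOp E →L[ℂ] ℂ

variable {E}

/-- The vector functional `ω_{ξ,η}(x) = ⟨x ξ, η⟩`, for the scalar product that is linear in the
first slot. Mathlib's `inner` is linear in the second slot, so this is `inner ℂ η (x ξ)`. -/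
def vectorFunctional (ξ η : E) : BDual E :=
  (innerSL ℂ η).comp (ContinuousLinearMap.apply ℂ E ξ)

/-- The norm closure of the convex hull of `{ω_{ξ,η} : ξ, η ∈ V}`. All vector functionals are
normal and the normal functionals form a norm-closed subspace of the dual of `B(E)`, so the closure
in the dual is the closure in the predual. -/
def hullK (V : Set E) : Set (BDual E) :=
  closure (convexHull ℝ {ψ : BDual E | ∃ ξ ∈ V, ∃ η ∈ V, ψ = vectorFunctional ξ η})

/-- The Minkowski functional `q_K(ψ) = inf {α ≥ 0 : ψ ∈ α K}`, which is `∞` if there is no such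
`α`. -/
def minkowski (K : Set (BDual E)) (ψ : BDual E) : ℝ≥0∞ :=
  ⨅ (α : ℝ≥0) (_ : ψ ∈ (α : ℝ) • K), (α : ℝ≥0∞)

/-- The rank of `ξ` relative to `V`: the least number of terms in a representation of `ξ` as a
linear combination of elements of `V`, and `∞` if there is none. -/
def relRank (V : Set E) (ξ : E) : ℕ∞ :=
  ⨅ (m : ℕ) (_ : ∃ (c : Fin m → ℂ) (η : Fin m → E), (∀ i, η i ∈ V) ∧ ξ = ∑ i, c i • η i), (m : ℕ∞)

/-- The unit vectors of rank at most `l` relative to `V`. -/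
def rankAtMost (V : Set E) (l : ℕ) : Set E :=
  {ξ : E | ‖ξ‖ = 1 ∧ relRank V ξ ≤ l}

variable [CompleteSpace E]

variable (E) in
/-- The index set of a fixed orthonormal basis of the Hilbert space `E`. -/
def basisIndex : Set E := (exists_hilbertBasis ℂ E).choose

variable (E) in
/-- A fixed orthonormal basis of the Hilbert space `E`. -/
def someBasis : HilbertBasis (basisIndex E) ℂ E := (exists_hilbertBasis ℂ E).choose_spec.choose

/-- `T` is of trace class: `∑ ⟨|T| b, b⟩ < ∞` over an orthonormal basis, where `|T| = √(T* T)`. -/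
def IsTraceClass (T : BOp E) : Prop :=
  Summable fun i => (inner ℂ (someBasis E i) (CFC.abs T (someBasis E i))).re

/-- The trace (of a trace-class operator), `tr T = ∑ ⟨T b, b⟩` over an orthonormal basis. -/
def opTrace (T : BOp E) : ℂ := ∑' i, inner ℂ (someBasis E i) (T (someBasis E i))

/-- `φ` is normal: `φ(x) = tr(Φ x)` for some trace-class operator `Φ`. -/
def IsNormalFunctional (φ : BDual E) : Prop :=
  ∃ Φ : BOp E, IsTraceClass Φ ∧ ∀ x : BOp E, φ x = opTrace (Φ.comp x)

/-- A normal state: a normal positive linear functional of norm one. -/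
def IsNormalState (φ : BDual E) : Prop :=
  IsNormalFunctional φ ∧ (∀ x : BOp E, x.IsPositive → 0 ≤ φ x) ∧ ‖φ‖ = 1

end General

section Bipartite

variable (H : Type*) [NormedAddCommGroup H] [InnerProductSpace ℂ H]

/-- The Hilbert space tensor product `H ⊗ H`: the completion of the algebraic one. -/
abbrev HTensor : Type _ := UniformSpace.Completion (H ⊗[ℂ] H)

variable {H}

/-- The product vector `η ⊗ ζ`. -/
def prodVec (η ζ : H) : HTensor H := ((η ⊗ₜ[ℂ] ζ : H ⊗[ℂ] H) : HTensor H)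

variable (H)

/-- The flip operator, determined by `η ⊗ ζ ↦ ζ ⊗ η`. -/
def flip : BOp (HTensor H) :=
  ((TensorProduct.commIsometry ℂ H H : (H ⊗[ℂ] H) ≃ₗᵢ[ℂ] (H ⊗[ℂ] H)) :
    (H ⊗[ℂ] H) →L[ℂ] (H ⊗[ℂ] H)).completion

/-- The projection `P₋ = (1 - flip) / 2` onto the fermionic subspace. -/
def antisymProj : BOp (HTensor H) := (2⁻¹ : ℂ) • (1 - flip H)

/-- The fermionic subspace `P₋ (H ⊗ H)`. -/
abbrev fermionSubspace : Submodule ℂ (HTensor H) := (antisymProj H).range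

/-- The fermionic Hilbert space `H ∧ H`. -/
abbrev HWedge : Type _ := fermionSubspace H

theorem flip_flip (x : HTensor H) : flip H (flip H x) = x := by
  induction x using UniformSpace.Completion.induction_on with
  | hp => exact isClosed_eq (by fun_prop) (by fun_prop)
  | ih a =>
    simp [flip, ContinuousLinearMap.completion_apply_coe]

theorem antisymProj_idem : IsIdempotentElem (antisymProj H) := by
  ext x
  simp only [antisymProj, mul_apply_eq_comp, smul_apply,
    sub_apply, one_apply_eq_self, map_smul, map_sub, flip_flip]
  module

instance : CompleteSpace (HWedge H) :=
  (ContinuousLinearMap.IsIdempotentElem.isClosed_range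
    (antisymProj_idem H)).completeSpace_coe

/-- `P₋` as a map from `H ⊗ H` onto `H ∧ H`. -/
def antisym : HTensor H →L[ℂ] HWedge H :=
  (antisymProj H).codRestrict (fermionSubspace H) fun x => LinearMap.mem_range_self _ x

/-- The compression `x ↦ P₋ x P₋` as a map from `B(H ⊗ H)` to `B(H ∧ H)`. -/
def compress : BOp (HTensor H) →L[ℂ] BOp (HWedge H) :=
  (ContinuousLinearMap.compL ℂ (HWedge H) (HTensor H) (HWedge H) (antisym H)).comp
    ((ContinuousLinearMap.compL ℂ (HWedge H) (HTensor H) (HTensor H)).flip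
      (fermionSubspace H).subtypeL)

variable {H}

/-- A functional on `B(H ∧ H)` considered as a functional on `B(H ⊗ H)`: `x ↦ φ(P₋ x P₋)`. -/
def extend (φ : BDual (HWedge H)) : BDual (HTensor H) := φ.comp (compress H)

/-- `η ∧ ζ = √2 P₋ (η ⊗ ζ)`, as an element of `H ∧ H`. -/
def wedge (η ζ : H) : HWedge H := ((√2 : ℝ) : ℂ) • antisym H (prodVec η ζ)

variable (H)

/-- The unit product vectors of `H ⊗ H`. -/
def productVectors : Set (HTensor H) :=
  {ξ | ∃ η ζ : H, ‖η‖ = 1 ∧ ‖ζ‖ = 1 ∧ ξ = prodVec η ζ}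

/-- The unit vectors of the form `η ∧ ζ`. -/
def wedgeVectors : Set (HWedge H) :=
  {ξ | ‖ξ‖ = 1 ∧ ∃ η ζ : H, ξ = wedge η ζ}

/-- `K_l^{⊗2}`, generated by the unit vectors of Schmidt rank at most `l`. -/
def schmidtK (l : ℕ) : Set (BDual (HTensor H)) := hullK (rankAtMost (productVectors H) l)

/-- `K_l^{∧2}`, generated by the unit vectors of Slater rank at most `l`. -/
def slaterK (l : ℕ) : Set (BDual (HWedge H)) := hullK (rankAtMost (wedgeVectors H) l)

variable {H}

/-- `q_{K_l^{⊗2}}(φ)` of a functional `φ` on `B(H ∧ H)`, considered on `B(H ⊗ H)`. -/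
def qSchmidt (l : ℕ) (φ : BDual (HWedge H)) : ℝ≥0∞ := minkowski (schmidtK H l) (extend φ)

/-- `q_{K_l^{∧2}}(φ)` of a functional `φ` on `B(H ∧ H)`. -/
def qSlater (l : ℕ) (φ : BDual (HWedge H)) : ℝ≥0∞ := minkowski (slaterK H l) φ

/-- `(1 / √k) ∑ e_i ∧ f_i`. -/
def slaterVec {k : ℕ} (e f : Fin k → H) : HWedge H :=
  (((√k : ℝ) : ℂ)⁻¹) • ∑ i, wedge (e i) (f i)

end Bipartite

end Entanglement

end

/-! Both inequalities move generators along a map between the operator algebras. Write `q_⊗` and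
`q_∧` for the two gauges.

Since `√2 (η ∧ ζ) = η ⊗ ζ - ζ ⊗ η`, Slater rank at most `l` forces Schmidt rank at most `2l`. A unit
vector of Schmidt rank at most `2l` splits into two orthogonal pieces of rank at most `l`, whose
norms sum to at most `√2`. Expanding `ω_{a,b}` sesquilinearly over the pieces gives four terms of
total weight at most `√2 · √2 = 2`, whence `q_⊗ ≤ 2 q_∧`
(`vectorFunctional_mem_of_relRank_le_two_mul`). Conversely `P₋` is a contraction that sends products
to multiples of wedges, so it maps rank-`l` generators into `K_l^{∧2}`, and `q_∧ ≤ q_⊗`.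

Lower bounds come from evaluating at one operator (`le_minkowski`). The identity gives `q_∧ ≥ 1` on
states. The projection onto `ξ_k` gives `q_⊗ ≥ 2` for `k = l`: up to scale `ξ_k` is maximally
entangled with `2k` terms, so its squared overlap with unit vectors of Schmidt rank at most `l` is
at most `l / (2k)` (`norm_sq_inner_le`). -/

namespace Entanglement

/-! ### Vector functionals, hulls, gauges and ranks -/

section General

variable {E F : Type*} [NormedAddCommGroup E] [InnerProductSpace ℂ E]
  [NormedAddCommGroup F] [InnerProductSpace ℂ F]

@[simp]
theorem vectorFunctional_apply (ξ η : E) (x : BOp E) :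
    vectorFunctional ξ η x = inner ℂ η (x ξ) := rfl

theorem norm_vectorFunctional_le (ξ η : E) : ‖vectorFunctional ξ η‖ ≤ ‖ξ‖ * ‖η‖ := by
  refine ContinuousLinearMap.opNorm_le_bound _ (by positivity) fun x => ?_
  rw [vectorFunctional_apply]
  calc ‖inner ℂ η (x ξ)‖ ≤ ‖η‖ * ‖x ξ‖ := norm_inner_le_norm _ _
    _ ≤ ‖η‖ * (‖x‖ * ‖ξ‖) := by gcongr; exact x.le_opNorm ξ
    _ = ‖ξ‖ * ‖η‖ * ‖x‖ := by ring

theorem vectorFunctional_add_add (a₁ a₂ b₁ b₂ : E) :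
    vectorFunctional (a₁ + a₂) (b₁ + b₂) =
      (vectorFunctional a₁ b₁ + vectorFunctional a₁ b₂) +
        (vectorFunctional a₂ b₁ + vectorFunctional a₂ b₂) := by
  ext x
  simp [add_add_add_comm]

theorem convex_hullK (V : Set E) : Convex ℝ (hullK V) := (convex_convexHull ℝ _).closure

theorem vectorFunctional_mem_hullK {V : Set E} {ξ η : E} (hξ : ξ ∈ V) (hη : η ∈ V) :
    vectorFunctional ξ η ∈ hullK V :=
  subset_closure (subset_convexHull ℝ _ ⟨ξ, hξ, η, hη, rfl⟩)

theorem hullK_subset {V : Set E} {S : Set (BDual E)} (hS : IsClosed S) (hc : Convex ℝ S)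
    (h : ∀ ξ ∈ V, ∀ η ∈ V, vectorFunctional ξ η ∈ S) : hullK V ⊆ S := by
  refine closure_minimal (convexHull_min ?_ hc) hS
  rintro _ ⟨ξ, hξ, η, hη, rfl⟩
  exact h ξ hξ η hη

/-- Precomposition with `T` is linear and continuous, and `r • hullK W` is closed and convex, so
checking generators suffices. -/
theorem comp_mem_smul_hullK {V : Set E} {W : Set F} {r : ℝ} (hr : r ≠ 0) (T : BOp F →L[ℂ] BOp E)
    (h : ∀ ξ ∈ V, ∀ η ∈ V, (vectorFunctional ξ η).comp T ∈ r • hullK W) {α : ℝ} {ψ : BDual E}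
    (hψ : ψ ∈ α • hullK V) : ψ.comp T ∈ (r * α) • hullK W := by
  obtain ⟨χ, hχ, rfl⟩ := hψ
  have key : hullK V ⊆ (fun χ : BDual E => χ.comp T) ⁻¹' (r • hullK W) := by
    refine hullK_subset ?_ ?_ h
    · exact (isClosed_closure.smul_of_ne_zero hr).preimage (by fun_prop)
    · intro x hx y hy a b ha hb hab
      have := ((convex_hullK W).smul r) hx hy ha hb hab
      exact this
  obtain ⟨χ', h1, h2⟩ := key hχ
  refine ⟨χ', h1, ?_⟩
  have h3 : r • χ' = χ.comp T := h2
  change (r * α) • χ' = (α • χ).comp T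
  rw [mul_comm, mul_smul, h3]
  rfl

theorem relRank_le_iff {V : Set E} {ξ : E} {l : ℕ} :
    relRank V ξ ≤ l ↔ ∃ m ≤ l, ∃ (c : Fin m → ℂ) (η : Fin m → E),
      (∀ i, η i ∈ V) ∧ ξ = ∑ i, c i • η i := by
  constructor
  · intro h
    have h' : relRank V ξ < (l + 1 : ℕ) := lt_of_le_of_lt h (by exact_mod_cast Nat.lt_succ_self l)
    simp only [relRank, iInf_lt_iff] at h'
    obtain ⟨m, hm, hlt⟩ := h'
    exact ⟨m, Nat.lt_succ_iff.mp (by exact_mod_cast hlt), hm⟩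
  · rintro ⟨m, hm, h⟩
    exact (iInf₂_le m h).trans (by exact_mod_cast hm)

/-- Zero summands are allowed and discarded: in the applications `V` consists of unit vectors, and a
product or wedge may vanish. -/
theorem relRank_sum_le {V : Set E} {ι : Type*} (s : Finset ι) (x : ι → E)
    (h : ∀ i ∈ s, x i = 0 ∨ ∃ (c : ℂ) (v : E), v ∈ V ∧ x i = c • v) :
    relRank V (∑ i ∈ s, x i) ≤ s.card := by
  classical
  set t := s.filter fun i => x i ≠ 0 with ht
  have h' : ∀ i : t, ∃ (c : ℂ) (v : E), v ∈ V ∧ x i = c • v := by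
    rintro ⟨i, hi⟩
    rw [ht, Finset.mem_filter] at hi
    exact (h i hi.1).resolve_left hi.2
  choose c v hv hx using h'
  refine relRank_le_iff.2 ⟨t.card, Finset.card_filter_le _ _, fun i => c (t.equivFin.symm i),
    fun i => v (t.equivFin.symm i), fun i => hv _, ?_⟩
  rw [Equiv.sum_comp t.equivFin.symm fun i => c i • v i, ← Finset.sum_filter_ne_zero, ← ht,
    ← Finset.sum_coe_sort]
  exact Finset.sum_congr rfl fun i _ => hx i

theorem relRank_smul_le {V : Set E} {ξ : E} {l : ℕ} (h : relRank V ξ ≤ l) (a : ℂ) :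
    relRank V (a • ξ) ≤ l := by
  obtain ⟨m, hm, c, η, hη, rfl⟩ := relRank_le_iff.1 h
  refine relRank_le_iff.2 ⟨m, hm, fun i => a * c i, η, hη, ?_⟩
  simp [Finset.smul_sum, mul_smul]

theorem normalize_mem_rankAtMost {V : Set E} {ξ : E} {l : ℕ} (h : relRank V ξ ≤ l) (h0 : ξ ≠ 0) :
    ((‖ξ‖ : ℂ)⁻¹) • ξ ∈ rankAtMost V l :=
  ⟨norm_smul_inv_norm h0, relRank_smul_le h _⟩

theorem neg_mem_rankAtMost {V : Set E} {ξ : E} {l : ℕ} (h : ξ ∈ rankAtMost V l) :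
    -ξ ∈ rankAtMost V l := by
  refine ⟨by rw [norm_neg, h.1], ?_⟩
  simpa using relRank_smul_le h.2 (-1)

/-- Zero is the midpoint of `ω_{ξ,ξ}` and `ω_{ξ,-ξ}`. -/
theorem zero_mem_hullK {V : Set E} {l : ℕ} (hV : (rankAtMost V l).Nonempty) :
    (0 : BDual E) ∈ hullK (rankAtMost V l) := by
  obtain ⟨ξ, hξ⟩ := hV
  have := convex_hullK _ (vectorFunctional_mem_hullK hξ hξ)
    (vectorFunctional_mem_hullK hξ (neg_mem_rankAtMost hξ)) (a := 1 / 2) (b := 1 / 2)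
    (by norm_num) (by norm_num) (by norm_num)
  convert this using 1
  ext x
  simp

theorem vectorFunctional_mem_smul_hullK {V : Set E} {l : ℕ} (hV : (rankAtMost V l).Nonempty)
    {ξ η : E} (hξ : relRank V ξ ≤ l) (hη : relRank V η ≤ l) :
    vectorFunctional ξ η ∈ (‖ξ‖ * ‖η‖) • hullK (rankAtMost V l) := by
  by_cases h : ξ = 0 ∨ η = 0
  · refine ⟨0, zero_mem_hullK hV, ?_⟩
    ext x
    rcases h with rfl | rfl <;> simp
  · push Not at h
    have h1 : (‖ξ‖ : ℂ) ≠ 0 := by simpa using h.1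
    have h2 : (‖η‖ : ℂ) ≠ 0 := by simpa using h.2
    refine ⟨_, vectorFunctional_mem_hullK (normalize_mem_rankAtMost hξ h.1)
      (normalize_mem_rankAtMost hη h.2), ?_⟩
    ext x
    simp
    field_simp

/-- A convex set containing `0` has dilates that increase with the factor. -/
theorem smul_hullK_mono {V : Set E} {l : ℕ} (hV : (rankAtMost V l).Nonempty) {s t : ℝ}
    (hs : 0 ≤ s) (hst : s ≤ t) :
    s • hullK (rankAtMost V l) ⊆ t • hullK (rankAtMost V l) := by
  rintro _ ⟨χ, hχ, rfl⟩
  have h := (convex_hullK _).add_smul hs (sub_nonneg.2 hst) (s := rankAtMost V l |> hullK)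
  rw [add_sub_cancel] at h
  rw [h]
  exact ⟨s • χ, ⟨χ, hχ, rfl⟩, 0, ⟨0, zero_mem_hullK hV, smul_zero _⟩, add_zero _⟩

theorem minkowski_le {K : Set (BDual E)} {ψ : BDual E} {α : ℝ≥0} (h : ψ ∈ (α : ℝ) • K) :
    minkowski K ψ ≤ α := iInf₂_le α h

/-- Evaluation at an operator bounds the Minkowski functional from below. -/
theorem le_minkowski {V : Set E} {ψ : BDual E} (x : BOp E) {r s : ℝ≥0} (hr : 0 < r)
    (hV : ∀ ξ ∈ V, ∀ η ∈ V, ‖inner ℂ η (x ξ)‖ ≤ r) (hψ : r * s ≤ ‖ψ x‖) :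
    (s : ℝ≥0∞) ≤ minkowski (hullK V) ψ := by
  refine le_iInf₂ fun α hα => ?_
  obtain ⟨χ, hχ, rfl⟩ := hα
  -- The bound on generators passes to the hull because a closed disc is closed and convex.
  have key : hullK V ⊆ (fun χ : BDual E => χ x) ⁻¹' Metric.closedBall 0 r := by
    refine hullK_subset (Metric.isClosed_closedBall.preimage (by fun_prop)) ?_ ?_
    · intro a ha b hb p q hp hq hpq
      exact convex_closedBall (0 : ℂ) (r : ℝ) ha hb hp hq hpq
    · intro ξ hξ η hη
      simpa using hV ξ hξ η hη
  have h1 : ‖χ x‖ ≤ r := by simpa using key hχ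
  have h2 : ‖((α : ℝ) • χ) x‖ = α * ‖χ x‖ := by
    simp
  have h3 : (r : ℝ) * s ≤ r * α := by
    calc (r : ℝ) * s ≤ α * ‖χ x‖ := hψ.trans h2.le
      _ ≤ α * r := by gcongr
      _ = r * α := mul_comm _ _
  have h4 : (s : ℝ) ≤ α := le_of_mul_le_mul_left h3 (by exact_mod_cast hr)
  exact_mod_cast h4

variable [CompleteSpace E]

theorem isNormalFunctional_vectorFunctional (ξ : E) :
    IsNormalFunctional (vectorFunctional ξ ξ) := by
  have hpos : (0 : BOp E) ≤ InnerProductSpace.rankOne ℂ ξ ξ := by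
    rw [ContinuousLinearMap.nonneg_iff_isPositive]
    exact InnerProductSpace.isPositive_rankOne_self ξ
  refine ⟨InnerProductSpace.rankOne ℂ ξ ξ, ?_, fun x => ?_⟩
  · rw [IsTraceClass, CFC.abs_of_nonneg _ hpos]
    have := (someBasis E).summable_inner_mul_inner ξ ξ
    convert (Complex.hasSum_re this.hasSum).summable using 3 with i
    simp [InnerProductSpace.rankOne_apply]
  -- The trace of `|ξ⟩⟨ξ| x` is the Parseval sum for `⟨x* ξ, ξ⟩`.
  · have := (someBasis E).tsum_inner_mul_inner (x.adjoint ξ) ξ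
    rw [ContinuousLinearMap.adjoint_inner_left] at this
    rw [vectorFunctional_apply, ← this, opTrace]
    refine tsum_congr fun i => ?_
    simp [InnerProductSpace.rankOne_apply,
      ContinuousLinearMap.adjoint_inner_left]

theorem isNormalState_vectorFunctional {ξ : E} (hξ : ‖ξ‖ = 1) :
    IsNormalState (vectorFunctional ξ ξ) := by
  refine ⟨isNormalFunctional_vectorFunctional ξ, fun x hx => ?_, le_antisymm ?_ ?_⟩
  · exact hx.inner_nonneg_right ξ
  · simpa [hξ] using norm_vectorFunctional_le ξ ξ
  · have h := (vectorFunctional ξ ξ).le_opNorm 1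
    have h1 : ‖vectorFunctional ξ ξ 1‖ = 1 := by
      simp [hξ]
    rw [h1] at h
    have h2 : ‖(1 : BOp E)‖ ≤ 1 := ContinuousLinearMap.norm_id_le
    calc (1 : ℝ) ≤ ‖vectorFunctional ξ ξ‖ * ‖(1 : BOp E)‖ := h
      _ ≤ ‖vectorFunctional ξ ξ‖ * 1 := by gcongr
      _ = _ := mul_one _

end General

/-! ### Schmidt rank and overlaps -/

section ProductVectors

variable {H : Type*} [NormedAddCommGroup H] [InnerProductSpace ℂ H]

@[simp]
theorem inner_prodVec (a b c d : H) :
    inner ℂ (prodVec a b) (prodVec c d) = inner ℂ a c * inner ℂ b d := by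
  simp [prodVec, UniformSpace.Completion.inner_coe]

@[simp]
theorem norm_prodVec (a b : H) : ‖prodVec a b‖ = ‖a‖ * ‖b‖ := by
  simp [prodVec]

theorem prodVec_smul_left (c : ℂ) (a b : H) : prodVec (c • a) b = c • prodVec a b := by
  simp only [prodVec, ← UniformSpace.Completion.coe_smul, TensorProduct.smul_tmul']

theorem prodVec_smul_right (c : ℂ) (a b : H) : prodVec a (c • b) = c • prodVec a b := by
  simp only [prodVec, ← UniformSpace.Completion.coe_smul, TensorProduct.tmul_smul]

theorem prodVec_neg_right (a b : H) : prodVec a (-b) = -prodVec a b := by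
  simpa using prodVec_smul_right (-1) a b

theorem prodVec_sum_left {ι : Type*} (s : Finset ι) (a : ι → H) (b : H) :
    prodVec (∑ i ∈ s, a i) b = ∑ i ∈ s, prodVec (a i) b := by
  simp only [prodVec, TensorProduct.sum_tmul]
  exact map_sum (UniformSpace.Completion.toComplL (𝕜 := ℂ) (E := H ⊗[ℂ] H)) _ _

theorem prodVec_sum_right {ι : Type*} (s : Finset ι) (a : H) (b : ι → H) :
    prodVec a (∑ i ∈ s, b i) = ∑ i ∈ s, prodVec a (b i) := by
  simp only [prodVec, TensorProduct.tmul_sum]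
  exact map_sum (UniformSpace.Completion.toComplL (𝕜 := ℂ) (E := H ⊗[ℂ] H)) _ _

@[simp]
theorem flip_prodVec (a b : H) : flip H (prodVec a b) = prodVec b a := by
  simp [flip, prodVec, ContinuousLinearMap.completion_apply_coe]

theorem prodVec_eq_smul (η ζ : H) :
    prodVec η ζ = 0 ∨ ∃ (c : ℂ) (v : HTensor H), v ∈ productVectors H ∧ prodVec η ζ = c • v := by
  by_cases h : η = 0 ∨ ζ = 0
  · left
    rw [← norm_eq_zero, norm_prodVec]
    rcases h with rfl | rfl <;> simp
  · push Not at h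
    right
    have h1 : (‖η‖ : ℂ) ≠ 0 := by simpa using h.1
    have h2 : (‖ζ‖ : ℂ) ≠ 0 := by simpa using h.2
    refine ⟨‖η‖ * ‖ζ‖, _, ⟨_, _, norm_smul_inv_norm (𝕜 := ℂ) h.1,
      norm_smul_inv_norm (𝕜 := ℂ) h.2, rfl⟩, ?_⟩
    rw [prodVec_smul_left, prodVec_smul_right, smul_smul, smul_smul]
    simp only [Complex.coe_algebraMap]
    field_simp
    simp

theorem relRank_sum_prodVec_le {ι : Type*} (s : Finset ι) (η ζ : ι → H) :
    relRank (productVectors H) (∑ i ∈ s, prodVec (η i) (ζ i)) ≤ s.card :=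
  relRank_sum_le s _ fun i _ => prodVec_eq_smul (η i) (ζ i)

theorem norm_sq_sum_prodVec {ι : Type*} (s : Finset ι) {g : ι → H} (hg : Orthonormal ℂ g)
    (w : ι → H) : ‖∑ j ∈ s, prodVec (g j) (w j)‖ ^ 2 = ∑ j ∈ s, ‖w j‖ ^ 2 := by
  classical
  have h : inner ℂ (∑ j ∈ s, prodVec (g j) (w j)) (∑ j ∈ s, prodVec (g j) (w j)) =
      ∑ j ∈ s, inner ℂ (w j) (w j) := by
    simp only [sum_inner, inner_sum, inner_prodVec, orthonormal_iff_ite.1 hg]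
    refine Finset.sum_congr rfl fun i hi => ?_
    simp [hi]
  simp only [inner_self_eq_norm_sq_to_K] at h
  exact_mod_cast h

/-- A sum of product vectors can be rewritten with orthonormal first factors. -/
theorem exists_orthonormal_sum_prodVec {ξ : HTensor H} {l : ℕ}
    (h : relRank (productVectors H) ξ ≤ l) :
    ∃ n ≤ l, ∃ g w : Fin n → H, Orthonormal ℂ g ∧ ξ = ∑ j, prodVec (g j) (w j) := by
  obtain ⟨m, hm, c, x, hx, rfl⟩ := relRank_le_iff.1 h
  choose η ζ _ _ hx using hx
  set S := Submodule.span ℂ (Set.range η)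
  have hS : Module.finrank ℂ S ≤ m := by
    exact (finrank_range_le_card (R := ℂ) (b := η)).trans_eq (Fintype.card_fin m)
  have : FiniteDimensional ℂ S := FiniteDimensional.span_of_finite ℂ (Set.finite_range η)
  -- Expanding the left factors in an orthonormal basis of their span moves all coefficients to the
  -- right factors; the span has dimension at most `m`.
  let b := stdOrthonormalBasis ℂ S
  refine ⟨Module.finrank ℂ S, hS.trans hm, fun j => (b j : H),
    fun j => ∑ i, (c i * inner ℂ (b j : H) (η i)) • ζ i, ?_, ?_⟩
  · exact b.orthonormal.comp_linearIsometry S.subtypeₗᵢ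
  · have hη : ∀ i, η i = ∑ j, inner ℂ (b j : H) (η i) • (b j : H) := by
      intro i
      have := b.sum_repr' ⟨η i, Submodule.subset_span ⟨i, rfl⟩⟩
      simpa using (congrArg (Subtype.val) this).symm
    simp only [prodVec_sum_right, prodVec_smul_right]
    rw [Finset.sum_comm]
    refine Finset.sum_congr rfl fun i _ => ?_
    rw [hx i]
    nth_rewrite 1 [hη i]
    simp only [prodVec_sum_left, prodVec_smul_left, Finset.smul_sum, smul_smul]

/-- With orthonormal first factors, the partial sums over `s` and `sᶜ` are orthogonal, so Pythagoras
applies. -/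
theorem exists_add_of_relRank_le_two_mul {ξ : HTensor H} {l : ℕ}
    (h : relRank (productVectors H) ξ ≤ (2 * l : ℕ)) :
    ∃ ξ₁ ξ₂ : HTensor H, ξ = ξ₁ + ξ₂ ∧ relRank (productVectors H) ξ₁ ≤ l ∧
      relRank (productVectors H) ξ₂ ≤ l ∧ ‖ξ₁‖ ^ 2 + ‖ξ₂‖ ^ 2 = ‖ξ‖ ^ 2 := by
  obtain ⟨n, hn, g, w, hg, rfl⟩ := exists_orthonormal_sum_prodVec h
  obtain ⟨s, hs, hsc⟩ : ∃ s : Finset (Fin n), s.card ≤ l ∧ sᶜ.card ≤ l := by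
    obtain ⟨s, -, hs⟩ := Finset.exists_subset_card_eq (s := (Finset.univ : Finset (Fin n)))
      (n := min n l) (by simp)
    refine ⟨s, by omega, ?_⟩
    rw [Finset.card_compl, Fintype.card_fin]
    omega
  refine ⟨∑ j ∈ s, prodVec (g j) (w j), ∑ j ∈ sᶜ, prodVec (g j) (w j),
    (Finset.sum_add_sum_compl s _).symm, ?_, ?_, ?_⟩
  · exact (relRank_sum_prodVec_le _ _ _).trans (by exact_mod_cast hs)
  · exact (relRank_sum_prodVec_le _ _ _).trans (by exact_mod_cast hsc)
  · simp only [norm_sq_sum_prodVec _ hg, Finset.sum_add_sum_compl]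

/-- Cauchy–Schwarz and two Bessel inequalities give a bound independent of the number of terms. -/
theorem norm_inner_prodVec_sum_le {ι : Type*} [Fintype ι] {u v : ι → H} (hu : Orthonormal ℂ u)
    (hv : Orthonormal ℂ v) (g w : H) :
    ‖inner ℂ (prodVec g w) (∑ s, prodVec (u s) (v s))‖ ≤ ‖g‖ * ‖w‖ := by
  simp only [inner_sum, inner_prodVec]
  calc ‖∑ s, inner ℂ g (u s) * inner ℂ w (v s)‖
      ≤ ∑ s, ‖inner ℂ (u s) g‖ * ‖inner ℂ (v s) w‖ := by
        refine (norm_sum_le _ _).trans (le_of_eq (Finset.sum_congr rfl fun s _ => ?_))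
        rw [norm_mul, norm_inner_symm g, norm_inner_symm w]
    _ ≤ √(∑ s, ‖inner ℂ (u s) g‖ ^ 2) * √(∑ s, ‖inner ℂ (v s) w‖ ^ 2) :=
        Real.sum_mul_le_sqrt_mul_sqrt _ _ _
    _ ≤ ‖g‖ * ‖w‖ := by
        gcongr
        · exact Real.sqrt_le_iff.2 ⟨norm_nonneg _, hu.sum_inner_products_le g⟩
        · exact Real.sqrt_le_iff.2 ⟨norm_nonneg _, hv.sum_inner_products_le w⟩

/-- The overlap of a vector of Schmidt rank at most `l` with a vector that is maximally
entangled up to normalization. -/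
theorem norm_sq_inner_le {ι : Type*} [Fintype ι] {u v : ι → H} (hu : Orthonormal ℂ u)
    (hv : Orthonormal ℂ v) {a : HTensor H} {l : ℕ} (h : relRank (productVectors H) a ≤ l) :
    ‖inner ℂ a (∑ s, prodVec (u s) (v s))‖ ^ 2 ≤ l * ‖a‖ ^ 2 := by
  obtain ⟨n, hn, g, w, hg, rfl⟩ := exists_orthonormal_sum_prodVec h
  rw [norm_sq_sum_prodVec _ hg, sum_inner]
  calc ‖∑ j, inner ℂ (prodVec (g j) (w j)) (∑ s, prodVec (u s) (v s))‖ ^ 2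
      ≤ (∑ j, ‖w j‖) ^ 2 := by
        gcongr
        refine (norm_sum_le _ _).trans (Finset.sum_le_sum fun j _ => ?_)
        simpa [hg.1 j] using norm_inner_prodVec_sum_le hu hv (g j) (w j)
    -- Cauchy–Schwarz over the `n ≤ l` terms is where the rank enters.
    _ ≤ n * ∑ j, ‖w j‖ ^ 2 := by
        simpa using sq_sum_le_card_mul_sum_sq (s := Finset.univ) (f := fun j => ‖w j‖)
    _ ≤ l * ∑ j, ‖w j‖ ^ 2 := by
        gcongr

end ProductVectors

/-! ### Antisymmetrization and Slater rank -/

section Wedge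

variable {H : Type*} [NormedAddCommGroup H] [InnerProductSpace ℂ H]

theorem inner_flip_flip (x y : HTensor H) : inner ℂ (flip H x) (flip H y) = inner ℂ x y := by
  induction x, y using UniformSpace.Completion.induction_on₂ with
  | hp => exact isClosed_eq (by fun_prop) (by fun_prop)
  | ih a b =>
    simp [flip, ContinuousLinearMap.completion_apply_coe, UniformSpace.Completion.inner_coe]

theorem inner_flip_left (x y : HTensor H) : inner ℂ (flip H x) y = inner ℂ x (flip H y) := by
  rw [← inner_flip_flip x, flip_flip]

theorem inner_antisymProj_left (x y : HTensor H) :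
    inner ℂ (antisymProj H x) y = inner ℂ x (antisymProj H y) := by
  simp [antisymProj, inner_smul_left, inner_smul_right, inner_sub_left, inner_sub_right,
    inner_flip_left, Complex.conj_ofNat]

theorem antisymProj_coe (z : HWedge H) : antisymProj H (z : HTensor H) = z := by
  obtain ⟨_, y, rfl⟩ := z
  exact congrArg (fun T : BOp (HTensor H) => T y) (antisymProj_idem H)

theorem coe_antisym (x : HTensor H) : (antisym H x : HTensor H) = antisymProj H x := rfl

theorem inner_antisym_right (z : HWedge H) (x : HTensor H) :
    inner ℂ z (antisym H x) = inner ℂ (z : HTensor H) x := by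
  rw [Submodule.coe_inner, coe_antisym, ← inner_antisymProj_left, antisymProj_coe]

theorem inner_antisym_left (x : HTensor H) (z : HWedge H) :
    inner ℂ (antisym H x) z = inner ℂ x (z : HTensor H) := by
  rw [← inner_conj_symm, inner_antisym_right, inner_conj_symm]

theorem antisym_coe (z : HWedge H) : antisym H (z : HTensor H) = z :=
  Subtype.ext (antisymProj_coe z)

theorem norm_antisym_le (x : HTensor H) : ‖antisym H x‖ ≤ ‖x‖ := by
  by_cases h : ‖antisym H x‖ = 0
  · rw [h]; positivity
  · have h1 : ‖antisym H x‖ * ‖antisym H x‖ ≤ ‖x‖ * ‖antisym H x‖ := by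
      calc ‖antisym H x‖ * ‖antisym H x‖ = ‖inner ℂ (antisym H x) (antisym H x)‖ := by
            rw [inner_self_eq_norm_sq_to_K]; simp [sq]
        _ = ‖inner ℂ x (antisym H x : HTensor H)‖ := by rw [inner_antisym_left]
        _ ≤ _ := norm_inner_le_norm _ _
    exact le_of_mul_le_mul_right h1 (lt_of_le_of_ne (norm_nonneg _) (Ne.symm h))

theorem wedge_smul_left (c : ℂ) (η ζ : H) : wedge (c • η) ζ = c • wedge η ζ := by
  simp only [wedge, prodVec_smul_left, map_smul, smul_comm c]

/-- The sign sits in the second factor, so the first factors of a sum of wedges are exactly the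
given vectors and stay orthonormal. -/
theorem coe_wedge (η ζ : H) :
    (wedge η ζ : HTensor H) = ((√2 : ℝ) : ℂ)⁻¹ • (prodVec η ζ + prodVec ζ (-η)) := by
  have h : ((√2 : ℝ) : ℂ) * 2⁻¹ = ((√2 : ℝ) : ℂ)⁻¹ := by
    rw [← Complex.ofReal_inv, ← div_eq_mul_inv, ← Real.sqrt_div_self]
    push_cast
    rfl
  rw [wedge, Submodule.coe_smul, coe_antisym, antisymProj, smul_apply, smul_smul, h,
    prodVec_neg_right, ← sub_eq_add_neg]
  simp

theorem antisym_prodVec (η ζ : H) :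
    antisym H (prodVec η ζ) = wedge (((√2 : ℝ) : ℂ)⁻¹ • η) ζ := by
  rw [wedge_smul_left, wedge, smul_smul, inv_mul_cancel₀ (by simp), one_smul]

theorem wedge_eq_smul (η ζ : H) :
    wedge η ζ = 0 ∨ ∃ (c : ℂ) (v : HWedge H), v ∈ wedgeVectors H ∧ wedge η ζ = c • v := by
  by_cases h : wedge η ζ = 0
  · exact Or.inl h
  · refine Or.inr ⟨‖wedge η ζ‖, _, ⟨norm_smul_inv_norm (𝕜 := ℂ) h, _, _,
      (wedge_smul_left _ _ _).symm⟩, ?_⟩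
    have h' : (‖wedge η ζ‖ : ℂ) ≠ 0 := Complex.ofReal_ne_zero.2 (norm_ne_zero_iff.2 h)
    exact (smul_inv_smul₀ h' _).symm

theorem relRank_sum_wedge_le {ι : Type*} (s : Finset ι) (η ζ : ι → H) :
    relRank (wedgeVectors H) (∑ i ∈ s, wedge (η i) (ζ i)) ≤ s.card :=
  relRank_sum_le s _ fun i _ => wedge_eq_smul (η i) (ζ i)

theorem relRank_antisym_le {ξ : HTensor H} {l : ℕ} (h : relRank (productVectors H) ξ ≤ l) :
    relRank (wedgeVectors H) (antisym H ξ) ≤ l := by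
  obtain ⟨n, hn, g, w, -, rfl⟩ := exists_orthonormal_sum_prodVec h
  simp only [map_sum, antisym_prodVec]
  refine (relRank_sum_wedge_le Finset.univ _ _).trans ?_
  simpa using hn

theorem coe_sum_wedge {ι : Type*} [Fintype ι] (η ζ : ι → H) :
    ((∑ i, wedge (η i) (ζ i) : HWedge H) : HTensor H) =
      ((√2 : ℝ) : ℂ)⁻¹ • ∑ s, prodVec (Sum.elim η ζ s) (Sum.elim ζ (-η) s) := by
  simp [coe_wedge, Finset.smul_sum, Finset.sum_add_distrib]

theorem relRank_coe_le {a : HWedge H} {l : ℕ} (h : relRank (wedgeVectors H) a ≤ l) :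
    relRank (productVectors H) (a : HTensor H) ≤ (2 * l : ℕ) := by
  obtain ⟨m, hm, c, x, hx, rfl⟩ := relRank_le_iff.1 h
  choose _ η ζ hx using hx
  simp only [hx, ← wedge_smul_left]
  rw [coe_sum_wedge (fun i => c i • η i) ζ]
  refine relRank_smul_le ((relRank_sum_prodVec_le Finset.univ _ _).trans ?_) _
  simp only [Finset.card_univ, Fintype.card_sum, Fintype.card_fin]
  exact_mod_cast (by omega : m + m ≤ 2 * l)

theorem vectorFunctional_comp_compress (a b : HWedge H) :
    (vectorFunctional a b).comp (compress H) =
      vectorFunctional (a : HTensor H) (b : HTensor H) := by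
  ext x
  exact inner_antisym_right b (x a)

theorem extend_vectorFunctional (a b : HWedge H) :
    extend (vectorFunctional a b) = vectorFunctional (a : HTensor H) (b : HTensor H) :=
  vectorFunctional_comp_compress a b

variable (H) in
/-- The embedding `x ↦ x P₋` of `B(H ∧ H)` into `B(H ⊗ H)`. -/
noncomputable def inflate : BOp (HWedge H) →L[ℂ] BOp (HTensor H) :=
  (ContinuousLinearMap.compL ℂ (HTensor H) (HWedge H) (HTensor H)
    (fermionSubspace H).subtypeL).comp
    ((ContinuousLinearMap.compL ℂ (HTensor H) (HWedge H) (HWedge H)).flip (antisym H))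

theorem vectorFunctional_comp_inflate (ξ η : HTensor H) :
    (vectorFunctional ξ η).comp (inflate H) =
      vectorFunctional (antisym H ξ) (antisym H η) := by
  ext x
  exact (inner_antisym_left η (x (antisym H ξ))).symm

/-- Compressing `x P₋` to `H ∧ H` returns `x`. -/
theorem extend_comp_inflate (φ : BDual (HWedge H)) : (extend φ).comp (inflate H) = φ := by
  ext x
  change φ (compress H (inflate H x)) = φ x
  congr 1
  ext z
  change ((antisym H ((x (antisym H (z : HTensor H)) : HWedge H) : HTensor H) : HWedge H)
    : HTensor H) = x z
  rw [antisym_coe, antisym_coe]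

/-- If all wedges vanished, `P₋` would vanish on the dense span of product vectors. This makes the
generating set of `K_l^{∧2}` nonempty, hence `0` a member. -/
theorem exists_wedge_ne_zero [Nontrivial (HWedge H)] : ∃ η ζ : H, wedge η ζ ≠ 0 := by
  by_contra! h
  have h0 : ∀ x : HTensor H, antisym H x = 0 := by
    intro x
    induction x using UniformSpace.Completion.induction_on with
    | hp => exact isClosed_eq (by fun_prop) (by fun_prop)
    | ih a =>
      induction a with
      | zero => rw [UniformSpace.Completion.coe_zero, map_zero]
      | tmul η ζ => exact (antisym_prodVec η ζ).trans (h _ _)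
      | add a b ha hb => rw [UniformSpace.Completion.coe_add, map_add, ha, hb, add_zero]
  obtain ⟨z, hz⟩ := exists_ne (0 : HWedge H)
  exact hz (by rw [← antisym_coe z, h0])

end Wedge

/-! ### The two inequalities -/

section Comparison

variable {H : Type*} [NormedAddCommGroup H] [InnerProductSpace ℂ H]

theorem rankAtMost_nonempty {E : Type*} [NormedAddCommGroup E] [InnerProductSpace ℂ E]
    {V : Set E} {ξ : E} {l : ℕ} (h : relRank V ξ ≤ l) (h0 : ξ ≠ 0) :
    (rankAtMost V l).Nonempty := ⟨_, normalize_mem_rankAtMost h h0⟩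

theorem vectorFunctional_mem_of_relRank_le_two_mul {l : ℕ} {a b : HTensor H} (ha : ‖a‖ = 1)
    (hb : ‖b‖ = 1) (ha' : relRank (productVectors H) a ≤ (2 * l : ℕ))
    (hb' : relRank (productVectors H) b ≤ (2 * l : ℕ)) :
    vectorFunctional a b ∈ (2 : ℝ) • schmidtK H l := by
  obtain ⟨a₁, a₂, rfl, ha₁, ha₂, hna⟩ := exists_add_of_relRank_le_two_mul ha'
  obtain ⟨b₁, b₂, rfl, hb₁, hb₂, hnb⟩ := exists_add_of_relRank_le_two_mul hb'
  have hV : (rankAtMost (productVectors H) l).Nonempty := by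
    by_cases h : a₁ = 0
    · refine rankAtMost_nonempty ha₂ fun h' => ?_
      simp [h, h'] at ha
    · exact rankAtMost_nonempty ha₁ h
  rw [ha] at hna
  rw [hb] at hnb
  have hK := convex_hullK (rankAtMost (productVectors H) l)
  rw [vectorFunctional_add_add]
  refine smul_hullK_mono hV (s := (‖a₁‖ * ‖b₁‖ + ‖a₁‖ * ‖b₂‖) + (‖a₂‖ * ‖b₁‖ + ‖a₂‖ * ‖b₂‖))
    (by positivity) ?_ ?_
  -- The weight is `(‖a₁‖ + ‖a₂‖) (‖b₁‖ + ‖b₂‖)`, and each factor is at most `√2`.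
  · nlinarith [sq_nonneg (‖a₁‖ - ‖a₂‖), sq_nonneg (‖b₁‖ - ‖b₂‖),
      sq_nonneg (‖a₁‖ + ‖a₂‖ - (‖b₁‖ + ‖b₂‖))]
  · rw [hK.add_smul (by positivity) (by positivity), hK.add_smul (by positivity) (by positivity),
      hK.add_smul (by positivity) (by positivity)]
    exact Set.add_mem_add
      (Set.add_mem_add (vectorFunctional_mem_smul_hullK hV ha₁ hb₁)
        (vectorFunctional_mem_smul_hullK hV ha₁ hb₂))
      (Set.add_mem_add (vectorFunctional_mem_smul_hullK hV ha₂ hb₁)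
        (vectorFunctional_mem_smul_hullK hV ha₂ hb₂))

theorem half_qSchmidt_le_qSlater (l : ℕ) (φ : BDual (HWedge H)) :
    (1 / 2) * qSchmidt l φ ≤ qSlater l φ := by
  refine le_iInf₂ fun α hα => ?_
  have h : extend φ ∈ ((2 : ℝ) * α) • schmidtK H l := by
    refine comp_mem_smul_hullK two_ne_zero (compress H) (fun ξ hξ η hη => ?_) hα
    rw [vectorFunctional_comp_compress]
    exact vectorFunctional_mem_of_relRank_le_two_mul hξ.1 hη.1 (relRank_coe_le hξ.2)
      (relRank_coe_le hη.2)
  calc (1 / 2) * qSchmidt l φ ≤ (1 / 2) * ((2 * α : ℝ≥0) : ℝ≥0∞) := by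
        gcongr
        exact minkowski_le (by simpa using h)
    _ = α := by
        rw [ENNReal.coe_mul, ← mul_assoc, one_div, ENNReal.coe_ofNat,
          ENNReal.inv_mul_cancel two_ne_zero ENNReal.ofNat_ne_top, one_mul]

theorem qSlater_le_qSchmidt [Nontrivial (HWedge H)] {l : ℕ} (hl : 1 ≤ l)
    (φ : BDual (HWedge H)) : qSlater l φ ≤ qSchmidt l φ := by
  have hV : (rankAtMost (wedgeVectors H) l).Nonempty := by
    obtain ⟨η, ζ, h⟩ := exists_wedge_ne_zero (H := H)
    refine rankAtMost_nonempty (ξ := wedge η ζ) ?_ h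
    have := relRank_sum_wedge_le (Finset.univ : Finset Unit) (fun _ => η) (fun _ => ζ)
    simp only [Finset.univ_unique, Finset.sum_const, Finset.card_singleton, one_smul] at this
    exact this.trans (by exact_mod_cast hl)
  refine le_iInf₂ fun α hα => minkowski_le ?_
  have h : (extend φ).comp (inflate H) ∈ ((1 : ℝ) * α) • slaterK H l := by
    refine comp_mem_smul_hullK one_ne_zero (inflate H) (fun ξ hξ η hη => ?_) hα
    rw [vectorFunctional_comp_inflate]
    refine smul_hullK_mono hV (by positivity) ?_
      (vectorFunctional_mem_smul_hullK hV (relRank_antisym_le hξ.2) (relRank_antisym_le hη.2))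
    exact mul_le_one₀ ((norm_antisym_le ξ).trans_eq hξ.1) (norm_nonneg _)
      ((norm_antisym_le η).trans_eq hη.1)
  rwa [extend_comp_inflate, one_mul] at h

/-- Norm one excludes the degenerate case `H ∧ H = 0`, where `K_l^{∧2}` is empty. -/
theorem nontrivial_of_isNormalState {φ : BDual (HWedge H)} (hφ : IsNormalState φ) :
    Nontrivial (HWedge H) := by
  by_contra h
  rw [not_nontrivial_iff_subsingleton] at h
  have h0 : φ = 0 := by
    ext x
    rw [Subsingleton.elim x 0]
    simp
  simpa [h0] using hφ.2.2

end Comparison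

/-! ### The explicit states and sharpness -/

section SlaterVectors

variable {H : Type*} [NormedAddCommGroup H] [InnerProductSpace ℂ H] {k : ℕ} {e f : Fin k → H}

theorem orthonormal_elim_neg (h : Orthonormal ℂ (Sum.elim e f)) :
    Orthonormal ℂ (Sum.elim f (-e)) := by
  constructor
  · rintro (i | i)
    · exact h.1 (Sum.inr i)
    · simpa using h.1 (Sum.inl i)
  · rintro (i | i) (j | j) hij
    · exact h.2 (i := Sum.inr i) (j := Sum.inr j) (by simpa using hij)
    · simpa using h.2 (i := Sum.inr i) (j := Sum.inl j) (by simp)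
    · simpa using h.2 (i := Sum.inl i) (j := Sum.inr j) (by simp)
    · simpa using h.2 (i := Sum.inl i) (j := Sum.inl j) (by simpa using hij)

theorem coe_slaterVec (e f : Fin k → H) :
    (slaterVec e f : HTensor H) =
      ((√(2 * k) : ℝ) : ℂ)⁻¹ • ∑ s, prodVec (Sum.elim e f s) (Sum.elim f (-e) s) := by
  rw [slaterVec, Submodule.coe_smul, coe_sum_wedge, smul_smul, ← mul_inv, ← Complex.ofReal_mul,
    mul_comm (√(k : ℝ)), ← Real.sqrt_mul zero_le_two]

theorem norm_slaterVec (hk : 1 ≤ k) (h : Orthonormal ℂ (Sum.elim e f)) :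
    ‖slaterVec e f‖ = 1 := by
  have hk' : (0 : ℝ) < 2 * k := by positivity
  have h1 : ‖∑ s, prodVec (Sum.elim e f s) (Sum.elim f (-e) s)‖ ^ 2 = 2 * k := by
    rw [norm_sq_sum_prodVec _ h]
    simp only [(orthonormal_elim_neg h).1]
    simp
    ring
  change ‖(slaterVec e f : HTensor H)‖ = 1
  rw [coe_slaterVec, norm_smul, norm_inv, Complex.norm_real,
    Real.norm_of_nonneg (Real.sqrt_nonneg _), ← Real.sqrt_sq (norm_nonneg (∑ s, _)), h1,
    inv_mul_cancel₀ (Real.sqrt_ne_zero'.2 hk')]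

theorem relRank_slaterVec_le (e f : Fin k → H) :
    relRank (wedgeVectors H) (slaterVec e f) ≤ k := by
  refine relRank_smul_le ?_ _
  simpa using relRank_sum_wedge_le Finset.univ e f

theorem norm_sq_inner_slaterVec_le (hk : 1 ≤ k) (h : Orthonormal ℂ (Sum.elim e f)) {l : ℕ}
    {a : HTensor H} (ha : a ∈ rankAtMost (productVectors H) l) :
    ‖inner ℂ a (slaterVec e f : HTensor H)‖ ^ 2 ≤ l / (2 * k) := by
  have hk' : (0 : ℝ) < 2 * k := by positivity
  have := norm_sq_inner_le h (orthonormal_elim_neg h) ha.2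
  rw [ha.1, one_pow, mul_one] at this
  rw [coe_slaterVec, inner_smul_right, norm_mul, norm_inv, Complex.norm_real,
    Real.norm_of_nonneg (Real.sqrt_nonneg _), mul_pow, inv_pow, Real.sq_sqrt hk'.le,
    div_eq_inv_mul]
  gcongr

theorem one_le_qSlater_vectorFunctional (l : ℕ) {ξ : HWedge H} (hξ : ‖ξ‖ = 1) :
    1 ≤ qSlater l (vectorFunctional ξ ξ) := by
  refine le_minkowski (r := 1) (s := 1) 1 one_pos (fun a ha b hb => ?_) ?_
  · refine (norm_inner_le_norm _ _).trans ?_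
    simp [ha.1, hb.1]
  · simp [hξ]

theorem qSchmidt_vectorFunctional_le_one {l : ℕ} {ξ : HWedge H} (hξ : ‖ξ‖ = 1)
    (h : relRank (productVectors H) (ξ : HTensor H) ≤ l) :
    qSchmidt l (vectorFunctional ξ ξ) ≤ 1 := by
  refine minkowski_le (α := 1) ?_
  rw [NNReal.coe_one, one_smul, extend_vectorFunctional]
  exact vectorFunctional_mem_hullK ⟨hξ, h⟩ ⟨hξ, h⟩

theorem qSlater_vectorFunctional_le_one {l : ℕ} {ξ : HWedge H} (hξ : ‖ξ‖ = 1)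
    (h : relRank (wedgeVectors H) ξ ≤ l) :
    qSlater l (vectorFunctional ξ ξ) ≤ 1 := by
  refine minkowski_le (α := 1) ?_
  rw [NNReal.coe_one, one_smul]
  exact vectorFunctional_mem_hullK ⟨hξ, h⟩ ⟨hξ, h⟩

/-- The lower bound is witnessed by the projection onto the vector itself. -/
theorem two_le_qSchmidt_slaterVec (hk : 1 ≤ k) (h : Orthonormal ℂ (Sum.elim e f)) :
    2 ≤ qSchmidt k (vectorFunctional (slaterVec e f) (slaterVec e f)) := by
  set ξ : HTensor H := (slaterVec e f : HTensor H) with hξ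
  have hn : ‖ξ‖ = 1 := norm_slaterVec hk h
  have hk' : (0 : ℝ) < k := by positivity
  have hsq : ∀ a ∈ rankAtMost (productVectors H) k, ‖inner ℂ a ξ‖ ^ 2 ≤ 1 / 2 := by
    intro a ha
    refine (norm_sq_inner_slaterVec_le hk h ha).trans_eq ?_
    field_simp
  -- On generators the projection has modulus `|⟨a, ξ⟩| |⟨b, ξ⟩| ≤ 1/2`, while `ω_ξ` takes the value
  -- `1`.
  refine le_minkowski (r := 1 / 2) (s := 2) (InnerProductSpace.rankOne ℂ ξ ξ) (by norm_num)
    (fun a ha b hb => ?_) ?_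
  · rw [InnerProductSpace.rankOne_apply, inner_smul_right, norm_mul, norm_inner_symm ξ a]
    push_cast
    nlinarith [hsq a ha, hsq b hb, sq_nonneg (‖inner ℂ a ξ‖ - ‖inner ℂ b ξ‖)]
  · rw [extend_vectorFunctional, vectorFunctional_apply, InnerProductSpace.rankOne_apply,
      ← hξ, inner_self_eq_norm_sq_to_K, hn]
    simp [hn]

theorem qSlater_slaterVec {l : ℕ} (hk : 1 ≤ k) (h : Orthonormal ℂ (Sum.elim e f)) (hkl : k ≤ l) :
    qSlater l (vectorFunctional (slaterVec e f) (slaterVec e f)) = 1 :=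
  le_antisymm (qSlater_vectorFunctional_le_one (norm_slaterVec hk h)
    ((relRank_slaterVec_le e f).trans (by exact_mod_cast hkl)))
    (one_le_qSlater_vectorFunctional l (norm_slaterVec hk h))

theorem qSchmidt_slaterVec_of_two_mul_le {l : ℕ} (hk : 1 ≤ k)
    (h : Orthonormal ℂ (Sum.elim e f)) (hkl : 2 * k ≤ l) :
    qSchmidt l (vectorFunctional (slaterVec e f) (slaterVec e f)) = 1 := by
  have hn := norm_slaterVec hk h
  have : Nontrivial (HWedge H) := nontrivial_of_ne _ 0 (norm_ne_zero_iff.1 (hn ▸ one_ne_zero))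
  -- The lower bound is inherited from `1 ≤ q_∧ ≤ q_⊗`.
  refine le_antisymm (qSchmidt_vectorFunctional_le_one hn ?_)
    ((one_le_qSlater_vectorFunctional l hn).trans (qSlater_le_qSchmidt (by omega) _))
  exact (relRank_coe_le (relRank_slaterVec_le e f)).trans (by exact_mod_cast hkl)

theorem qSchmidt_slaterVec_self (hk : 1 ≤ k) (h : Orthonormal ℂ (Sum.elim e f)) :
    qSchmidt k (vectorFunctional (slaterVec e f) (slaterVec e f)) = 2 := by
  refine le_antisymm ?_ (two_le_qSchmidt_slaterVec hk h)
  have := half_qSchmidt_le_qSlater k (vectorFunctional (slaterVec e f) (slaterVec e f))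
  rw [qSlater_slaterVec hk h le_rfl, one_div,
    ENNReal.inv_mul_le_iff two_ne_zero ENNReal.ofNat_ne_top, mul_one] at this
  exact this

theorem exists_orthonormal_elim (hH : ¬ FiniteDimensional ℂ H) (k : ℕ) :
    ∃ e f : Fin k → H, Orthonormal ℂ (Sum.elim e f) := by
  have hrank : ((k + k : ℕ) : Cardinal) ≤ Module.rank ℂ H := by
    refine (Cardinal.natCast_lt_aleph0.le).trans ?_
    rw [← not_lt]
    exact fun h => hH (Module.rank_lt_aleph0_iff.1 h)
  obtain ⟨s, hs⟩ := (le_rank_iff_exists_linearIndependent_finset (n := k + k)).1 hrank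
  obtain ⟨hs, hli⟩ := hs
  let b : Fin (k + k) → H := fun i => (s.equivFinOfCardEq hs).symm i
  have hb : LinearIndependent ℂ b := hli.comp _ (Equiv.injective _)
  have ho := InnerProductSpace.gramSchmidtNormed_orthonormal hb
  have ho' := ho.comp finSumFinEquiv finSumFinEquiv.injective
  rw [← Sum.elim_comp_inl_inr (InnerProductSpace.gramSchmidtNormed ℂ b ∘ finSumFinEquiv)] at ho'
  exact ⟨_, _, ho'⟩

end SlaterVectors

end Entanglement

theorem proposition8 {H : Type*} [NormedAddCommGroup H] [InnerProductSpace ℂ H] [CompleteSpace H]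
    (l : ℕ) (hl : 2 ≤ l) :
    -- the chain of inequalities
    (∀ φ : Entanglement.BDual (Entanglement.HWedge H), Entanglement.IsNormalState φ →
      (1 / 2) * Entanglement.qSchmidt l φ ≤ Entanglement.qSlater l φ ∧
      Entanglement.qSlater l φ ≤ Entanglement.qSchmidt l φ) ∧
    -- the explicit states
    (∀ (k : ℕ) (e f : Fin k → H), 1 ≤ k → Orthonormal ℂ (Sum.elim e f) →
      Entanglement.IsNormalState
        (Entanglement.vectorFunctional (Entanglement.slaterVec e f)
          (Entanglement.slaterVec e f)) ∧
      (2 * k ≤ l →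
        Entanglement.qSchmidt l (Entanglement.vectorFunctional (Entanglement.slaterVec e f)
          (Entanglement.slaterVec e f)) = 1 ∧
        Entanglement.qSlater l (Entanglement.vectorFunctional (Entanglement.slaterVec e f)
          (Entanglement.slaterVec e f)) = 1) ∧
      (k = l →
        Entanglement.qSchmidt l (Entanglement.vectorFunctional (Entanglement.slaterVec e f)
          (Entanglement.slaterVec e f)) = 2 ∧
        Entanglement.qSlater l (Entanglement.vectorFunctional (Entanglement.slaterVec e f)
          (Entanglement.slaterVec e f)) = 1)) ∧
    -- both inequalities are attained, at finite values, and the constants are optimal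
    (¬ FiniteDimensional ℂ H →
      (∃ φ : Entanglement.BDual (Entanglement.HWedge H), Entanglement.IsNormalState φ ∧
        (1 / 2) * Entanglement.qSchmidt l φ = Entanglement.qSlater l φ ∧
        Entanglement.qSlater l φ = 1) ∧
      (∃ φ : Entanglement.BDual (Entanglement.HWedge H), Entanglement.IsNormalState φ ∧
        Entanglement.qSlater l φ = Entanglement.qSchmidt l φ ∧
        Entanglement.qSlater l φ = 1) ∧
      (∀ c : ENNReal, (∀ φ : Entanglement.BDual (Entanglement.HWedge H),
        Entanglement.IsNormalState φ →
          c * Entanglement.qSchmidt l φ ≤ Entanglement.qSlater l φ) → c ≤ 1 / 2) ∧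
      (∀ c : ENNReal, (∀ φ : Entanglement.BDual (Entanglement.HWedge H),
        Entanglement.IsNormalState φ →
          Entanglement.qSlater l φ ≤ c * Entanglement.qSchmidt l φ) → 1 ≤ c)) := by
  have explicit : ∀ (k : ℕ) (e f : Fin k → H), 1 ≤ k → Orthonormal ℂ (Sum.elim e f) →
      Entanglement.IsNormalState
        (Entanglement.vectorFunctional (Entanglement.slaterVec e f)
          (Entanglement.slaterVec e f)) := fun k e f hk h =>
    Entanglement.isNormalState_vectorFunctional (Entanglement.norm_slaterVec hk h)
  refine ⟨fun φ hφ => ⟨Entanglement.half_qSchmidt_le_qSlater l φ, ?_⟩,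
    fun k e f hk h => ⟨explicit k e f hk h, fun hkl => ⟨?_, ?_⟩, ?_⟩, fun hH => ?_⟩
  · have := Entanglement.nontrivial_of_isNormalState hφ
    exact Entanglement.qSlater_le_qSchmidt (by omega) φ
  · exact Entanglement.qSchmidt_slaterVec_of_two_mul_le hk h hkl
  · exact Entanglement.qSlater_slaterVec hk h (by omega)
  · rintro rfl
    exact ⟨Entanglement.qSchmidt_slaterVec_self hk h, Entanglement.qSlater_slaterVec hk h le_rfl⟩
  · have hl1 : 1 ≤ l := by omega
    -- The case `k = l` saturates the left inequality and `k = 1` the right one; the latter needs `2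
    -- ≤ l`.
    obtain ⟨e, f, h⟩ := Entanglement.exists_orthonormal_elim hH l
    obtain ⟨e', f', h'⟩ := Entanglement.exists_orthonormal_elim hH 1
    have h₁ := Entanglement.qSchmidt_slaterVec_self hl1 h
    have h₂ := Entanglement.qSlater_slaterVec hl1 h le_rfl
    have h₃ := Entanglement.qSchmidt_slaterVec_of_two_mul_le le_rfl h' (l := l) (by omega)
    have h₄ := Entanglement.qSlater_slaterVec le_rfl h' hl1
    refine ⟨⟨_, explicit l e f hl1 h, ?_, h₂⟩, ⟨_, explicit 1 e' f' le_rfl h', ?_, h₄⟩,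
      fun c hc => ?_, fun c hc => ?_⟩
    · rw [h₁, h₂, one_div, ENNReal.inv_mul_cancel two_ne_zero ENNReal.ofNat_ne_top]
    · rw [h₃, h₄]
    · have := hc _ (explicit l e f hl1 h)
      rw [h₁, h₂] at this
      rwa [ENNReal.le_div_iff_mul_le (by simp) (by simp)]
    · have := hc _ (explicit 1 e' f' le_rfl h')
      rwa [h₃, h₄, mul_one] at this
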